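/- Let $(M,\mathring g)$ be a nonempty compact smooth Riemannian manifold without boundary (of any dimension), with Laplace–Beltrami operator $\Delta_{\mathring g}=\operatorname{tr}_{\mathring g}\nabla^2$, and let $\mathring R,\alpha,\beta:M\to\mathbb R$ be continuous functions with $\beta^2>0$ everywhere. Consider the equation $$\Delta_{\mathring g}\phi-\frac{\mathring R}{8}\,\phi=-\frac{\beta^2}{8}\,\phi^{5}-\frac{\alpha^2}{8}\,\phi^{-7}\qquad(\ast)$$ for positive functions $\phi\in C^2(M)$. Suppose that $$\min_M \alpha^2\cdot\min_M\beta^4\;\ge\;\frac{4}{27}\,\max_M \mathring R^3 .\qquad(\ast\ast)$$ Then $(\ast)$ has no positive solution, unless $\mathring R$, $\alpha^2$ and $\beta^2$ are all positive constants and $(\ast\ast)$ is an equality. In that case $(\ast)$ has exactly one positive solution, namely the constant function $$\phi=\Big(\frac{2\mathring R}{3\beta^2}\Big)^{1/4}.$$ -/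

import Mathlib

open scoped Manifold ContDiff

noncomputable section

namespace Lichnerowicz

/-- The `i`-th partial derivative of a real function on `ℝⁿ`. -/
def pderiv {n : ℕ} (i : Fin n) (f : EuclideanSpace ℝ (Fin n) → ℝ)
    (u : EuclideanSpace ℝ (Fin n)) : ℝ :=
  fderiv ℝ f u (EuclideanSpace.single i 1)

/-- Smooth Riemannian metrics on an `n`-dimensional manifold without boundary: smooth fields of
positive definite inner products on the tangent spaces. -/
abbrev Metric (n : ℕ) (M : Type*) [TopologicalSpace M]
    [ChartedSpace (EuclideanSpace ℝ (Fin n)) M] [IsManifold (𝓡 n) ∞ M] :=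
  Bundle.ContMDiffRiemannianMetric (𝓡 n) ∞ (EuclideanSpace ℝ (Fin n))
    (fun x : M => TangentSpace (𝓡 n) x)

variable {n : ℕ} {M : Type*} [TopologicalSpace M] [ChartedSpace (EuclideanSpace ℝ (Fin n)) M]
  [IsManifold (𝓡 n) ∞ M]

/-- The coordinate vector field `∂ᵢ` of the chart `e`, at the point with coordinates `u`. -/
def coordVector (e : OpenPartialHomeomorph M (EuclideanSpace ℝ (Fin n))) (i : Fin n)
    (u : EuclideanSpace ℝ (Fin n)) : TangentSpace (𝓡 n) (e.symm u) :=
  mfderiv (𝓡 n) (𝓡 n) e.symm u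
    (EuclideanSpace.single i 1 : EuclideanSpace ℝ (Fin n))

/-- The matrix `gᵢⱼ = g(∂ᵢ, ∂ⱼ)` of the metric in the chart `e`, as a function of the
coordinates. -/
def gram (g : Metric n M) (e : OpenPartialHomeomorph M (EuclideanSpace ℝ (Fin n)))
    (u : EuclideanSpace ℝ (Fin n)) : Matrix (Fin n) (Fin n) ℝ :=
  Matrix.of fun i j => g.inner (e.symm u) (coordVector e i u) (coordVector e j u)

/-- The Christoffel symbols of the Levi-Civita connection in the chart `e`:
`Γᵏᵢⱼ = ½ ∑ₗ gᵏˡ (∂ᵢ gⱼₗ + ∂ⱼ gᵢₗ - ∂ₗ gᵢⱼ)`. -/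
def christoffel (g : Metric n M) (e : OpenPartialHomeomorph M (EuclideanSpace ℝ (Fin n)))
    (k i j : Fin n) (u : EuclideanSpace ℝ (Fin n)) : ℝ :=
  (1 / 2) * ∑ l, (gram g e u)⁻¹ k l *
    (pderiv i (fun v => gram g e v j l) u + pderiv j (fun v => gram g e v i l) u
      - pderiv l (fun v => gram g e v i j) u)

/-- The Laplace-Beltrami operator in the chart `e`, i.e. the trace of the covariant Hessian:
`Δ φ = ∑ᵢⱼ gⁱʲ (∂ᵢ ∂ⱼ φ - ∑ₖ Γᵏᵢⱼ ∂ₖ φ)`, as a function of the coordinates. -/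
def laplacianInChart (g : Metric n M) (e : OpenPartialHomeomorph M (EuclideanSpace ℝ (Fin n)))
    (φ : M → ℝ) (u : EuclideanSpace ℝ (Fin n)) : ℝ :=
  ∑ i, ∑ j, (gram g e u)⁻¹ i j *
    (pderiv i (pderiv j (φ ∘ e.symm)) u
      - ∑ k, christoffel g e k i j u * pderiv k (φ ∘ e.symm) u)

/-- `φ` is a positive classical (`C²`) solution of the Lichnerowicz equation
`Δ φ - (R / 8) φ = - (β² / 8) φ⁵ - (α² / 8) φ⁻⁷`. The equation is required in every smooth chart;
at a given point the two sides do not depend on the chart. -/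
structure IsPositiveSolution (g : Metric n M) (R α β φ : M → ℝ) : Prop where
  contMDiff : ContMDiff (𝓡 n) 𝓘(ℝ, ℝ) 2 φ
  pos : ∀ x, 0 < φ x
  equation : ∀ e ∈ IsManifold.maximalAtlas (𝓡 n) ∞ M, ∀ x ∈ e.source,
    laplacianInChart g e φ (e x) - R x / 8 * φ x
      = - (β x ^ 2 / 8) * φ x ^ 5 - α x ^ 2 / 8 * φ x ^ (-7 : ℤ)

end Lichnerowicz

end

noncomputable section

namespace Lichnerowicz

open Filter Topology Metric Bundle

variable {n : ℕ}

local notation "𝔼" n => EuclideanSpace ℝ (Fin n)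

/-! With `s = φ⁴` the equation reads `Δφ = (R s² - β² s³ - α²) / (8 φ⁷)`. Where `R > 0`, the cubic
`R s² - β² s³` on `s > 0` peaks at `s = 2R / (3β²)` with value `4R³ / (27β⁴)`; where `R ≤ 0` it is
negative. The hypothesis thus says exactly enough to give `Δφ ≤ 0` (`mul_sq_sub_mul_cube_le`).

A superharmonic function on a compact manifold is locally constant
(`isLocallyConstant_of_laplacian_nonpos`), by Hopf's strong minimum principle applied in charts.
Hence `Δφ = 0`, so the cubic bound is an equality at every point (`IsPositiveSolution.rigidity`):
this fixes `φ⁴` and gives `α² β⁴ = (4/27) R³` pointwise. Since the hypothesis bounds the extrema of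
`R`, `α²`, `β²` separately, pointwise equality makes all three constant, even if `M` is
disconnected. -/

/-- The second order operator `∑ᵢⱼ aᵢⱼ ∂ᵢ∂ⱼ + ∑ₖ bₖ ∂ₖ` on functions on `ℝⁿ`. -/
def secondOrderOp (a : (𝔼 n) → Matrix (Fin n) (Fin n) ℝ) (b : Fin n → (𝔼 n) → ℝ)
    (u : (𝔼 n) → ℝ) (x : 𝔼 n) : ℝ :=
  ∑ i, ∑ j, a x i j * pderiv i (pderiv j u) x + ∑ k, b k x * pderiv k u x

/-! ### Second order operators on `ℝⁿ` and interior minima -/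

lemma pderiv_congr {i : Fin n} {f g : (𝔼 n) → ℝ} {x : 𝔼 n} (h : f =ᶠ[𝓝 x] g) :
    pderiv i f x = pderiv i g x := by
  simp only [pderiv, h.fderiv_eq]

lemma pderiv_eventuallyEq {i : Fin n} {f g : (𝔼 n) → ℝ} {x : 𝔼 n} (h : f =ᶠ[𝓝 x] g) :
    pderiv i f =ᶠ[𝓝 x] pderiv i g :=
  h.eventuallyEq_nhds.mono fun _ hy => pderiv_congr hy

lemma pderiv_const (i : Fin n) (c : ℝ) : pderiv i (fun _ : 𝔼 n => c) = fun _ => 0 := by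
  ext x
  simp [pderiv]

lemma pderiv_sub_const_mul {i : Fin n} {f g : (𝔼 n) → ℝ} {x : 𝔼 n} (c : ℝ)
    (hf : DifferentiableAt ℝ f x) (hg : DifferentiableAt ℝ g x) :
    pderiv i (fun y => f y - c * g y) x = pderiv i f x - c * pderiv i g x := by
  have := hf.hasFDerivAt.fun_sub (hg.hasFDerivAt.const_mul c)
  simp [pderiv, this.fderiv]

lemma contDiffAt_pderiv {i : Fin n} {f : (𝔼 n) → ℝ} {x : 𝔼 n} {m k : WithTop ℕ∞}
    (hf : ContDiffAt ℝ k f x) (h : m + 1 ≤ k) : ContDiffAt ℝ m (pderiv i f) x :=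
  (hf.fderiv_right h).clm_apply contDiffAt_const

lemma secondOrderOp_sub_const_mul (a : (𝔼 n) → Matrix (Fin n) (Fin n) ℝ)
    (b : Fin n → (𝔼 n) → ℝ) {u v : (𝔼 n) → ℝ} {x : 𝔼 n} (c : ℝ)
    (hu : ContDiffAt ℝ 2 u x) (hv : ContDiffAt ℝ 2 v x) :
    secondOrderOp a b (fun y => u y - c * v y) x
      = secondOrderOp a b u x - c * secondOrderOp a b v x := by
  have h1 : ∀ j : Fin n, pderiv j (fun y => u y - c * v y)
      =ᶠ[𝓝 x] fun y => pderiv j u y - c * pderiv j v y := by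
    intro j
    filter_upwards [hu.eventually (by simp), hv.eventually (by simp)] with y hy hy'
    exact pderiv_sub_const_mul c (hy.differentiableAt (by simp)) (hy'.differentiableAt (by simp))
  have h2 : ∀ i j : Fin n, pderiv i (pderiv j (fun y => u y - c * v y)) x
      = pderiv i (pderiv j u) x - c * pderiv i (pderiv j v) x := by
    intro i j
    rw [pderiv_congr (h1 j)]
    exact pderiv_sub_const_mul c
      ((contDiffAt_pderiv (m := 1) hu (by norm_num)).differentiableAt (by simp))
      ((contDiffAt_pderiv (m := 1) hv (by norm_num)).differentiableAt (by simp))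
  simp only [secondOrderOp, h2, fun j => (h1 j).self_of_nhds, mul_sub, Finset.sum_sub_distrib,
    mul_add, Finset.mul_sum, mul_left_comm c]
  ring

lemma fderiv_apply_eq_sum_pderiv (f : (𝔼 n) → ℝ) (x ξ : 𝔼 n) :
    fderiv ℝ f x ξ = ∑ i, ξ i * pderiv i f x := by
  have h : ξ = ∑ i, ξ i • EuclideanSpace.single i (1 : ℝ) := by
    ext j
    simp [Finset.sum_apply, Pi.single_apply]
  conv_lhs => rw [h]
  simp [pderiv]

/-- The second derivative of a function of a real variable is nonnegative at a local minimum. -/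
lemma deriv_deriv_nonneg_of_isLocalMin {f : ℝ → ℝ} {t : ℝ} (h : IsLocalMin f t)
    (hc : ContinuousAt f t) : 0 ≤ deriv (deriv f) t := by
  by_contra! hneg
  -- A negative second derivative would make `t` a local maximum as well, so `f` would be constant
  -- near `t`.
  have hmax := isLocalMax_of_deriv_deriv_neg hneg h.deriv_eq_zero hc
  have hconst : f =ᶠ[𝓝 t] fun _ => f t := by
    filter_upwards [h, hmax] with s hs hs'
    exact le_antisymm hs' hs
  have : deriv (deriv f) t = 0 := by
    rw [hconst.deriv.deriv_eq]
    simp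
  linarith

/-- Along the line `x + tξ` this reduces to one variable: the sum is the second derivative of the
restriction at `t = 0`. -/
lemma sum_pderiv_pderiv_nonneg_of_isLocalMin {w : (𝔼 n) → ℝ} {x : 𝔼 n}
    (hw : ContDiffAt ℝ 2 w x) (h : IsLocalMin w x) (ξ : Fin n → ℝ) :
    0 ≤ ∑ i, ∑ j, ξ i * ξ j * pderiv i (pderiv j w) x := by
  set η : 𝔼 n := WithLp.toLp 2 ξ with hη
  have hline : ∀ t : ℝ, HasDerivAt (fun t : ℝ => x + t • η) η t := fun t => by
    simpa using ((hasDerivAt_id t).smul_const η).const_add x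
  have hcont : Tendsto (fun t : ℝ => x + t • η) (𝓝 0) (𝓝 x) := by
    simpa using (hline 0).continuousAt.tendsto
  have h1 : deriv (fun t : ℝ => w (x + t • η))
      =ᶠ[𝓝 0] fun t => ∑ j, ξ j * pderiv j w (x + t • η) := by
    filter_upwards [hcont.eventually (hw.eventually (by simp))] with t ht
    have := ((ht.differentiableAt (by simp)).hasFDerivAt.comp_hasDerivAt t (hline t)).deriv
    rw [fderiv_apply_eq_sum_pderiv] at this
    exact this
  have h2 : deriv (fun t : ℝ => ∑ j, ξ j * pderiv j w (x + t • η)) 0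
      = ∑ j, ξ j * ∑ i, ξ i * pderiv i (pderiv j w) x := by
    refine HasDerivAt.deriv (HasDerivAt.fun_sum fun j _ => HasDerivAt.const_mul _ ?_)
    have hd : DifferentiableAt ℝ (pderiv j w) (x + (0 : ℝ) • η) := by
      simpa using (contDiffAt_pderiv (i := j) (m := 1) hw (by norm_num)).differentiableAt (by simp)
    have := hd.hasFDerivAt.comp_hasDerivAt (0 : ℝ) (hline 0)
    rw [fderiv_apply_eq_sum_pderiv, zero_smul, add_zero] at this
    exact this
  have hmin : IsLocalMin (fun t : ℝ => w (x + t • η)) 0 := by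
    have := hcont.eventually h
    simpa [IsLocalMin, IsMinFilter] using this
  have hc : ContinuousAt (fun t : ℝ => w (x + t • η)) 0 := by
    have : ContinuousAt w (x + (0 : ℝ) • η) := by simpa using hw.continuousAt
    exact this.comp (f := fun t : ℝ => x + t • η) (hline 0).continuousAt
  have := deriv_deriv_nonneg_of_isLocalMin hmin hc
  rw [h1.deriv_eq, h2] at this
  rw [Finset.sum_comm]
  simpa only [Finset.mul_sum, mul_assoc, mul_left_comm] using this

/-- The gradient vanishes, and factoring `a = BᵀB` splits the second order part into Hessian
quadratic forms along the rows of `B`. -/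
lemma secondOrderOp_nonneg_of_isLocalMin {a : (𝔼 n) → Matrix (Fin n) (Fin n) ℝ}
    {b : Fin n → (𝔼 n) → ℝ} {w : (𝔼 n) → ℝ} {x : 𝔼 n} (ha : (a x).PosDef)
    (hw : ContDiffAt ℝ 2 w x) (h : IsLocalMin w x) : 0 ≤ secondOrderOp a b w x := by
  have hgrad : ∀ k, pderiv k w x = 0 := fun k => by simp [pderiv, h.fderiv_eq_zero]
  obtain ⟨B, hB⟩ : ∃ B : Matrix (Fin n) (Fin n) ℝ, a x = B.conjTranspose * B := by
    open scoped MatrixOrder in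
    exact CStarAlgebra.nonneg_iff_eq_star_mul_self.mp ha.posSemidef.nonneg
  have : secondOrderOp a b w x
      = ∑ l, ∑ i, ∑ j, B l i * B l j * pderiv i (pderiv j w) x := by
    simp only [secondOrderOp, hgrad, mul_zero, Finset.sum_const_zero, add_zero, hB,
      Matrix.mul_apply, Matrix.conjTranspose_apply, star_trivial, Finset.sum_mul]
    conv_rhs => rw [Finset.sum_comm]
    refine Finset.sum_congr rfl fun i _ => ?_
    rw [Finset.sum_comm]
  rw [this]
  exact Finset.sum_nonneg fun l _ => sum_pderiv_pderiv_nonneg_of_isLocalMin hw h _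

/-! ### Hopf's strong minimum principle -/

/-- The Gaussian comparison function of the Hopf maximum principle. -/
def gaussian (k : ℝ) (y x : 𝔼 n) : ℝ := Real.exp (-k * ‖x - y‖ ^ 2)

lemma contDiff_gaussian (k : ℝ) (y : 𝔼 n) {m : WithTop ℕ∞} : ContDiff ℝ m (gaussian k y) :=
  (contDiff_const.mul ((contDiff_id.sub contDiff_const).norm_sq ℝ)).exp

lemma pderiv_gaussian (k : ℝ) (y : 𝔼 n) (j : Fin n) :
    pderiv j (gaussian k y) = fun x => -2 * k * ((x j - y j) * gaussian k y x) := by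
  ext x
  have h1 : HasFDerivAt (fun x : 𝔼 n => ‖x - y‖ ^ 2) (2 • (innerSL ℝ (x - y))) x := by
    simpa using ((hasFDerivAt_id x).sub_const y).norm_sq
  have h2 : HasFDerivAt (gaussian k y) _ x := (h1.const_mul (-k)).exp
  rw [pderiv, h2.fderiv]
  simp [gaussian, EuclideanSpace.inner_single_right]
  ring

lemma pderiv_pderiv_gaussian (k : ℝ) (y : 𝔼 n) (i j : Fin n) (x : 𝔼 n) :
    pderiv i (pderiv j (gaussian k y)) x
      = (4 * k ^ 2 * ((x i - y i) * (x j - y j)) - 2 * k * (if i = j then 1 else 0))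
        * gaussian k y x := by
  have hp : HasFDerivAt (fun x : 𝔼 n => x j - y j) (EuclideanSpace.proj j : (𝔼 n) →L[ℝ] ℝ) x :=
    (EuclideanSpace.proj j : (𝔼 n) →L[ℝ] ℝ).hasFDerivAt.sub_const _
  have hg := ((contDiff_gaussian k y (m := 1)).differentiable (by simp) x).hasFDerivAt
  have h := (hp.fun_mul hg).const_mul (-2 * k)
  have hgi : fderiv ℝ (gaussian k y) x (EuclideanSpace.single i 1)
      = -2 * k * ((x i - y i) * gaussian k y x) := congrFun (pderiv_gaussian k y i) x
  rw [pderiv_gaussian, pderiv, h.fderiv]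
  have hpi : (EuclideanSpace.proj j : (𝔼 n) →L[ℝ] ℝ) (EuclideanSpace.single i 1)
      = if i = j then 1 else 0 := by
    simp [eq_comm]
  simp only [smul_apply, add_apply, hgi, hpi, smul_eq_mul]
  split_ifs <;> ring

lemma secondOrderOp_gaussian (a : (𝔼 n) → Matrix (Fin n) (Fin n) ℝ) (b : Fin n → (𝔼 n) → ℝ)
    (k : ℝ) (y x : 𝔼 n) :
    secondOrderOp a b (gaussian k y) x
      = (4 * k ^ 2 * (∑ i, ∑ j, a x i j * ((x i - y i) * (x j - y j)))
          - 2 * k * (∑ i, a x i i + ∑ i, b i x * (x i - y i))) * gaussian k y x := by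
  have h1 : ∑ i, ∑ j, a x i j * pderiv i (pderiv j (gaussian k y)) x
      = (4 * k ^ 2 * (∑ i, ∑ j, a x i j * ((x i - y i) * (x j - y j)))
          - 2 * k * ∑ i, ∑ j, a x i j * (if i = j then 1 else 0)) * gaussian k y x := by
    simp only [pderiv_pderiv_gaussian, Finset.mul_sum, ← Finset.sum_sub_distrib, Finset.sum_mul]
    exact Finset.sum_congr rfl fun i _ => Finset.sum_congr rfl fun j _ => by ring
  have h2 : ∑ i, b i x * pderiv i (gaussian k y) x
      = - 2 * k * (∑ i, b i x * (x i - y i)) * gaussian k y x := by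
    simp only [pderiv_gaussian, Finset.mul_sum, Finset.sum_mul]
    exact Finset.sum_congr rfl fun i _ => by ring
  rw [secondOrderOp, h1, h2]
  simp
  ring

/-- The operator applied to the Gaussian is `2k(2kq - s)` times a positive factor, with `q(z) > 0`
by ellipticity. A large `k` makes it positive at `z`, hence nearby by continuity. -/
lemma exists_secondOrderOp_gaussian_pos {a : (𝔼 n) → Matrix (Fin n) (Fin n) ℝ}
    {b : Fin n → (𝔼 n) → ℝ} {y z : 𝔼 n} (ha : ∀ i j, ContinuousAt (fun x => a x i j) z)
    (hb : ∀ i, ContinuousAt (b i) z) (hpos : (a z).PosDef) (hyz : z ≠ y) :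
    ∃ k > 0, ∀ᶠ x in 𝓝 z, 0 < secondOrderOp a b (gaussian k y) x := by
  have hcoord : ∀ i : Fin n, ContinuousAt (fun x : 𝔼 n => x i - y i) z := fun i => by fun_prop
  have hq : ContinuousAt
      (fun x : 𝔼 n => ∑ i, ∑ j, a x i j * ((x i - y i) * (x j - y j))) z :=
    tendsto_finsetSum _ fun i _ => tendsto_finsetSum _ fun j _ =>
      (ha i j).mul ((hcoord i).mul (hcoord j))
  have hs : ContinuousAt
      (fun x : 𝔼 n => ∑ i, a x i i + ∑ i, b i x * (x i - y i)) z :=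
    ContinuousAt.add (tendsto_finsetSum _ fun i _ => ha i i)
      (tendsto_finsetSum _ fun i _ => (hb i).mul (hcoord i))
  have hqz : 0 < ∑ i, ∑ j, a z i j * ((z i - y i) * (z j - y j)) := by
    have hne : (fun i => z i - y i) ≠ 0 := fun h => hyz <| by
      ext i
      simpa [sub_eq_zero] using congrFun h i
    have := hpos.dotProduct_mulVec_pos hne
    simp only [dotProduct, Matrix.mulVec, Finset.mul_sum, Pi.star_apply, star_trivial] at this
    refine this.trans_eq (Finset.sum_congr rfl fun i _ => Finset.sum_congr rfl fun j _ => ?_)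
    ring
  set q : (𝔼 n) → ℝ := fun x => ∑ i, ∑ j, a x i j * ((x i - y i) * (x j - y j)) with hqdef
  set s : (𝔼 n) → ℝ := fun x => ∑ i, a x i i + ∑ i, b i x * (x i - y i) with hsdef
  replace hqz : 0 < q z := hqz
  obtain ⟨k, hk, hks⟩ : ∃ k > 0, s z < 2 * k * q z := by
    refine ⟨(|s z| + 1) / q z, by positivity, ?_⟩
    rw [mul_assoc, div_mul_cancel₀ _ hqz.ne']
    linarith [le_abs_self (s z), abs_nonneg (s z)]
  refine ⟨k, hk, ?_⟩
  filter_upwards [(hs.eventually_lt (hq.const_mul (2 * k)) hks :)] with x hx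
  rw [secondOrderOp_gaussian]
  refine mul_pos ?_ (Real.exp_pos _)
  change 0 < 4 * k ^ 2 * q x - 2 * k * s x
  have := mul_pos hk (sub_pos.mpr hx)
  nlinarith

/-- The ball with diameter `yz` touches the sphere about `y` through `z` only at `z`: the
parallelogram law gives `‖x - y‖² + ‖x - z‖² ≤ ‖z - y‖²`. -/
lemma dist_lt_of_mem_closedBall_midpoint {V : Type*} [NormedAddCommGroup V]
    [InnerProductSpace ℝ V] {x y z : V}
    (h : dist x (midpoint ℝ y z) ≤ dist z (midpoint ℝ y z)) (hxz : x ≠ z) :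
    dist x y < dist z y := by
  by_contra! hle
  set c := midpoint ℝ y z with hc
  have h1 : x - y = (x - c) + (z - c) := by
    rw [hc, midpoint_eq_smul_add, invOf_eq_inv]; module
  have h2 : z - y = (2 : ℝ) • (z - c) := by
    rw [hc, midpoint_eq_smul_add, invOf_eq_inv]; module
  have hp := parallelogram_law_with_norm ℝ (x - c) (z - c)
  rw [← h1, sub_sub_sub_cancel_right] at hp
  rw [dist_eq_norm, dist_eq_norm, h2, norm_smul, Real.norm_ofNat] at hle
  rw [dist_eq_norm, dist_eq_norm] at h
  have : 0 < ‖x - z‖ := norm_pos_iff.mpr (sub_ne_zero.mpr hxz)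
  nlinarith [norm_nonneg (x - c), norm_nonneg (z - c)]

/-- The **Hopf strong minimum principle**, in local form: a supersolution of an elliptic equation
without zeroth order term is constant near an interior minimum. -/
theorem eventually_eq_of_secondOrderOp_nonpos {a : (𝔼 n) → Matrix (Fin n) (Fin n) ℝ}
    {b : Fin n → (𝔼 n) → ℝ} {u : (𝔼 n) → ℝ} {U : Set (𝔼 n)} (hU : IsOpen U)
    (ha : ∀ i j, ContinuousOn (fun x => a x i j) U) (hb : ∀ i, ContinuousOn (b i) U)
    (hpos : ∀ x ∈ U, (a x).PosDef) (hu : ContDiffOn ℝ 2 u U)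
    (hL : ∀ x ∈ U, secondOrderOp a b u x ≤ 0) {x₀ : 𝔼 n} (hx₀ : x₀ ∈ U)
    (hmin : ∀ x ∈ U, u x₀ ≤ u x) : ∀ᶠ x in 𝓝 x₀, u x = u x₀ := by
  obtain ⟨r, hr, hrU⟩ := nhds_basis_closedBall.mem_iff.mp (hU.mem_nhds hx₀)
  -- Half the radius ensures that the minimum point nearest to `y` stays inside the ball about `x₀`.
  filter_upwards [ball_mem_nhds x₀ (half_pos hr)] with y hy
  by_contra hne
  have hK : IsCompact (closedBall x₀ r ∩ u ⁻¹' {u x₀}) :=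
    (isCompact_closedBall x₀ r).of_isClosed_subset
      ((hu.continuousOn.mono hrU).preimage_isClosed_of_isClosed isClosed_closedBall
        isClosed_singleton) Set.inter_subset_left
  -- `z` is the minimum point closest to `y`, so the open ball about `y` through `z` contains none.
  obtain ⟨z, ⟨-, hzu⟩, hzmin⟩ := hK.exists_isMinOn ⟨x₀, by simp [hr.le], by simp⟩
    (f := fun x => dist x y) (by fun_prop)
  simp only [Set.mem_preimage, Set.mem_singleton_iff] at hzu
  have hzy : dist z y ≤ dist x₀ y := hzmin ⟨by simp [hr.le], by simp⟩
  have hyx : dist x₀ y < r / 2 := by simpa [dist_comm] using hy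
  have hclose : ∀ x, dist x y ≤ dist z y → x ∈ ball x₀ r := fun x hx => by
    have := dist_triangle_right x x₀ y
    rw [mem_ball]
    linarith
  have hzball := hclose z le_rfl
  have hzU : z ∈ U := hrU (ball_subset_closedBall hzball)
  -- The smaller ball about `c` meets the minimum set only at `z`, even on its boundary.
  set c := midpoint ℝ y z with hc
  have hzne : z ≠ y := by
    rintro rfl
    exact hne hzu
  have hzc : z ≠ c := fun h => hzne (by
    have := h.symm
    rw [hc, midpoint_eq_right_iff] at this
    exact this.symm)
  have htouch : ∀ x ∈ closedBall c (dist z c), x ≠ z → x ∈ U ∧ u x₀ < u x := by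
    intro x hx hxz
    have hlt : dist x y < dist z y := dist_lt_of_mem_closedBall_midpoint hx hxz
    have hxball := ball_subset_closedBall (hclose x hlt.le)
    refine ⟨hrU hxball, (hmin x (hrU hxball)).lt_of_ne fun heq => ?_⟩
    exact hlt.not_ge (hzmin ⟨hxball, heq.symm⟩)
  obtain ⟨k, hk, hLv⟩ := exists_secondOrderOp_gaussian_pos
    (fun i j => (ha i j).continuousAt (hU.mem_nhds hzU))
    (fun i => (hb i).continuousAt (hU.mem_nhds hzU)) (hpos z hzU) hzc
  obtain ⟨δ, hδ, hδU⟩ := nhds_basis_closedBall.mem_iff.mp (inter_mem (hU.mem_nhds hzU) hLv)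
  set v := gaussian k c with hv
  have hv2 : ContDiff ℝ 2 v := contDiff_gaussian k c
  have hv0 : ∀ x, 0 < v x := fun x => Real.exp_pos _
  have hv1 : ∀ x, v x ≤ 1 := fun x => Real.exp_le_one_iff.mpr (by
    have : 0 ≤ k * ‖x - c‖ ^ 2 := by positivity
    linarith)
  have hsphere : ∀ p ∈ sphere z δ, p ≠ z := fun p hp h => by
    subst h
    simp at hp
    exact hδ.ne hp
  obtain ⟨ε, hε, hεu⟩ : ∃ ε > 0, ∀ p ∈ sphere z δ ∩ closedBall c (dist z c), u x₀ + ε ≤ u p := by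
    have hT : IsCompact (sphere z δ ∩ closedBall c (dist z c)) :=
      (isCompact_sphere z δ).inter_right isClosed_closedBall
    have hcont : ContinuousOn u (sphere z δ ∩ closedBall c (dist z c)) :=
      hu.continuousOn.mono fun p hp => (hδU (sphere_subset_closedBall hp.1)).1
    rcases (sphere z δ ∩ closedBall c (dist z c)).eq_empty_or_nonempty with hemp | hnon
    · exact ⟨1, one_pos, by simp [hemp]⟩
    · obtain ⟨p, hp, hpmin⟩ := hT.exists_isMinOn hnon hcont
      refine ⟨u p - u x₀, sub_pos.mpr (htouch p hp.2 (hsphere p hp.1)).2, fun p' hp' => ?_⟩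
      have : u p ≤ u p' := hpmin hp'
      linarith
  -- The minimum of `u - εv` is not attained on the sphere about `z`: within the ball about `c`, `u`
  -- exceeds its minimum by `ε` while `v ≤ 1`; outside it, `v < v z`. At an interior minimum `p` the
  -- operator is nonnegative on `u - εv`, against `Lu ≤ 0 < Lv`.
  obtain ⟨p, hp, hpmin⟩ := (isCompact_closedBall z δ).exists_isMinOn ⟨z, by simp [hδ.le]⟩
    (f := fun x => u x - ε * v x)
    ((hu.continuousOn.mono fun p hp => (hδU hp).1).sub
      (continuous_const.mul hv2.continuous).continuousOn)
  have hpz : u p - ε * v p ≤ u x₀ - ε * v z := by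
    have : u p - ε * v p ≤ u z - ε * v z := hpmin (by simp [hδ.le])
    rwa [hzu] at this
  have hpU : p ∈ U := (hδU hp).1
  have hpball : p ∈ ball z δ := by
    by_contra hnot
    have hps : p ∈ sphere z δ := le_antisymm hp (not_lt.mp hnot)
    by_cases hpc : p ∈ closedBall c (dist z c)
    · have := hεu p ⟨hps, hpc⟩
      nlinarith [mul_pos hε (hv0 z), mul_le_mul_of_nonneg_left (hv1 p) hε.le]
    · have hlt : v p < v z := by
        refine Real.exp_lt_exp.mpr ?_
        rw [mem_closedBall, not_le, dist_eq_norm, dist_eq_norm] at hpc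
        have := mul_lt_mul_of_pos_left (pow_lt_pow_left₀ hpc (norm_nonneg _) two_ne_zero) hk
        linarith
      have := hmin p hpU
      nlinarith [mul_lt_mul_of_pos_left hlt hε]
  have hlocal : IsLocalMin (fun x => u x - ε * v x) p := by
    filter_upwards [isOpen_ball.mem_nhds hpball] with x hx
    exact hpmin (ball_subset_closedBall hx)
  have hup : ContDiffAt ℝ 2 u p := hu.contDiffAt (hU.mem_nhds hpU)
  have h1 := secondOrderOp_nonneg_of_isLocalMin (b := b) (hpos p hpU)
    (hup.sub (contDiffAt_const.mul hv2.contDiffAt)) hlocal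
  have h2 := secondOrderOp_sub_const_mul a b ε hup hv2.contDiffAt
  have h3 : 0 < secondOrderOp a b v p := (hδU hp).2
  have := hL p hpU
  nlinarith [mul_pos hε h3]

variable {M : Type*} [TopologicalSpace M] [ChartedSpace (EuclideanSpace ℝ (Fin n)) M]
  [IsManifold (𝓡 n) ∞ M]

/-! ### The Laplacian in a chart as an elliptic operator -/

section Chart

variable {e : OpenPartialHomeomorph M (𝔼 n)}

/-- The coordinate field is the tangent map of `e.symm` applied to a constant section. -/
lemma contMDiffAt_coordVector (he : e ∈ IsManifold.maximalAtlas (𝓡 n) ∞ M) (i : Fin n) {u : 𝔼 n}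
    (hu : u ∈ e.target) :
    ContMDiffAt 𝓘(ℝ, 𝔼 n) (𝓡 n).tangent ∞
      (fun v => TotalSpace.mk' (𝔼 n) (E := fun x : M => TangentSpace (𝓡 n) x)
        (e.symm v) (coordVector e i v)) u := by
  have hsymm : ContMDiffOn (𝓡 n) (𝓡 n) ∞ e.symm e.target :=
    contMDiffOn_symm_of_mem_maximalAtlas he
  have h1 := hsymm.contMDiffOn_tangentMapWithin (m := ∞) (by simp) e.open_target.uniqueMDiffOn
  have h2 : ContMDiff 𝓘(ℝ, 𝔼 n) (𝓡 n).tangent ∞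
      (fun v : 𝔼 n => (⟨v, EuclideanSpace.single i 1⟩ : TangentBundle (𝓡 n) (𝔼 n))) :=
    contMDiff_vectorSpace_iff_contDiff.mpr contDiff_const
  have h3 := h1.comp h2.contMDiffOn (s := e.target) (fun v hv => hv)
  refine (h3.contMDiffAt (e.open_target.mem_nhds hu)).congr_of_eventuallyEq ?_
  filter_upwards [e.open_target.mem_nhds hu] with v hv
  simp only [Function.comp, tangentMapWithin, mfderivWithin_of_isOpen e.open_target hv]
  rfl

lemma contDiffOn_gram (g : Metric n M) (he : e ∈ IsManifold.maximalAtlas (𝓡 n) ∞ M)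
    (i j : Fin n) : ContDiffOn ℝ ∞ (fun u => gram g e u i j) e.target := by
  intro u hu
  have hb : ContMDiffAt 𝓘(ℝ, 𝔼 n) (𝓡 n) ∞ e.symm u :=
    (contMDiffOn_symm_of_mem_maximalAtlas he).contMDiffAt (e.open_target.mem_nhds hu)
  have h : ContMDiffAt 𝓘(ℝ, 𝔼 n) ((𝓡 n).prod 𝓘(ℝ, ℝ)) ∞
      (fun v => TotalSpace.mk' ℝ (E := Bundle.Trivial M ℝ) (e.symm v)
        (g.inner (e.symm v) (coordVector e i v) (coordVector e j v))) u := by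
    apply ContMDiffAt.clm_bundle_apply₂ (F₁ := 𝔼 n) (F₂ := 𝔼 n)
    · exact g.contMDiff.contMDiffAt.comp u hb
    · exact contMDiffAt_coordVector he i hu
    · exact contMDiffAt_coordVector he j hu
  simp only [contMDiffAt_totalSpace] at h
  exact h.2.contDiffAt.contDiffWithinAt

/-- The differential of `e.symm` is injective, so a nonzero `ξ` yields a nonzero tangent vector,
whose squared length is the quadratic form at `ξ`. -/
lemma gram_posDef (g : Metric n M) (he : e ∈ IsManifold.maximalAtlas (𝓡 n) ∞ M) {u : 𝔼 n}
    (hu : u ∈ e.target) : (gram g e u).PosDef := by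
  have hmd : e.MDifferentiable (𝓡 n) (𝓡 n) :=
    ⟨(contMDiffOn_of_mem_maximalAtlas he).mdifferentiableOn (by simp),
      (contMDiffOn_symm_of_mem_maximalAtlas he).mdifferentiableOn (by simp)⟩
  have hinj : Function.Injective (mfderiv (𝓡 n) (𝓡 n) e.symm u) := hmd.symm.mfderiv_injective hu
  refine Matrix.PosDef.of_dotProduct_mulVec_pos ?_ fun ξ hξ => ?_
  · ext i j
    simp [gram, g.symm _ (coordVector e i u)]
  · set X : TangentSpace (𝓡 n) (e.symm u) := ∑ i, ξ i • coordVector e i u with hX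
    have hsum : X = mfderiv (𝓡 n) (𝓡 n) e.symm u (WithLp.toLp 2 ξ : 𝔼 n) := by
      have h : (WithLp.toLp 2 ξ : 𝔼 n) = ∑ i, ξ i • EuclideanSpace.single i (1 : ℝ) := by
        ext j
        simp [Pi.single_apply]
      rw [h]
      erw [map_sum]
      refine Finset.sum_congr rfl fun i _ => ?_
      exact (map_smul (mfderiv (𝓡 n) (𝓡 n) e.symm u) (ξ i)
        (EuclideanSpace.single i (1 : ℝ) : 𝔼 n)).symm
    have hne : X ≠ 0 := by
      rw [hsum]
      intro h0
      have := hinj (h0.trans (map_zero _).symm)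
      exact hξ (congrArg (WithLp.ofLp (p := 2)) this)
    have := g.pos _ X hne
    have hval : g.inner (e.symm u) X X = star ξ ⬝ᵥ (gram g e u).mulVec ξ := by
      have h1 : ∀ Y, g.inner (e.symm u) X Y
          = ∑ i, ξ i * g.inner (e.symm u) (coordVector e i u) Y := fun Y => by
        rw [hX, map_sum, sum_apply]
        exact Finset.sum_congr rfl fun i _ => by rw [map_smul]; rfl
      have h2 : ∀ Y, g.inner (e.symm u) Y X
          = ∑ j, ξ j * g.inner (e.symm u) Y (coordVector e j u) := fun Y => by
        rw [hX, map_sum]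
        exact Finset.sum_congr rfl fun j _ => by rw [map_smul]; rfl
      simp only [h1, h2, dotProduct, Matrix.mulVec, gram, Matrix.of_apply, Pi.star_apply,
        star_trivial, mul_comm]
    rwa [← hval]

lemma continuousOn_gram_inv (g : Metric n M) (he : e ∈ IsManifold.maximalAtlas (𝓡 n) ∞ M)
    (i j : Fin n) : ContinuousOn (fun u => (gram g e u)⁻¹ i j) e.target := by
  have hgram : ContinuousOn (fun u => gram g e u) e.target :=
    continuousOn_pi.mpr fun i => continuousOn_pi.mpr fun j =>
      (contDiffOn_gram g he i j).continuousOn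
  have hinv : ContinuousOn (fun u => (gram g e u)⁻¹) e.target := by
    simp only [Matrix.inv_def, Ring.inverse_eq_inv']
    have hdet : Continuous fun A : Matrix (Fin n) (Fin n) ℝ => A.det := by fun_prop
    have hadj : Continuous fun A : Matrix (Fin n) (Fin n) ℝ => A.adjugate := by fun_prop
    exact ((hdet.comp_continuousOn hgram).inv₀ fun u hu => (gram_posDef g he hu).det_pos.ne').smul
      (hadj.comp_continuousOn hgram)
  exact (continuousOn_pi.mp (continuousOn_pi.mp hinv i)) j

lemma continuousOn_pderiv {f : (𝔼 n) → ℝ} {U : Set (𝔼 n)} (hU : IsOpen U)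
    (hf : ContDiffOn ℝ ∞ f U) (i : Fin n) : ContinuousOn (pderiv i f) U := fun _ hx =>
  (contDiffAt_pderiv (m := 0) (hf.contDiffAt (hU.mem_nhds hx))
    (by simp)).continuousAt.continuousWithinAt

lemma continuousOn_christoffel (g : Metric n M) (he : e ∈ IsManifold.maximalAtlas (𝓡 n) ∞ M)
    (k i j : Fin n) : ContinuousOn (christoffel g e k i j) e.target := by
  have hd : ∀ l i j, ContinuousOn (pderiv l fun v => gram g e v i j) e.target := fun l i j =>
    continuousOn_pderiv e.open_target (contDiffOn_gram g he i j) l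
  exact continuousOn_const.mul <| continuousOn_finsetSum _ fun l _ =>
    (continuousOn_gram_inv g he k l).mul (((hd i j l).add (hd j i l)).sub (hd l i j))

/-- The first order coefficients `-∑ᵢⱼ gⁱʲ Γᵏᵢⱼ` of the Laplacian in a chart. -/
def laplacianDrift (g : Metric n M) (e : OpenPartialHomeomorph M (𝔼 n)) (k : Fin n)
    (u : 𝔼 n) : ℝ :=
  ∑ i, ∑ j, (gram g e u)⁻¹ i j * -christoffel g e k i j u

lemma laplacianInChart_eq_secondOrderOp (g : Metric n M) (e : OpenPartialHomeomorph M (𝔼 n))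
    (φ : M → ℝ) (u : 𝔼 n) :
    laplacianInChart g e φ u
      = secondOrderOp (fun u => (gram g e u)⁻¹) (laplacianDrift g e) (φ ∘ e.symm) u := by
  have h : ∑ k, laplacianDrift g e k u * pderiv k (φ ∘ e.symm) u
      = -∑ i, ∑ j, (gram g e u)⁻¹ i j *
          ∑ k, christoffel g e k i j u * pderiv k (φ ∘ e.symm) u := by
    simp only [laplacianDrift, Finset.sum_mul, Finset.mul_sum, ← Finset.sum_neg_distrib]
    rw [Finset.sum_comm]
    refine Finset.sum_congr rfl fun i _ => ?_
    rw [Finset.sum_comm]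
    exact Finset.sum_congr rfl fun j _ => Finset.sum_congr rfl fun k _ => by ring
  simp only [laplacianInChart, secondOrderOp, h, mul_sub, Finset.sum_sub_distrib, ← sub_eq_add_neg]

lemma laplacianInChart_eq_zero (g : Metric n M) {φ : M → ℝ} {x : M} (hx : x ∈ e.source)
    (hφ : ∀ᶠ y in 𝓝 x, φ y = φ x) : laplacianInChart g e φ (e x) = 0 := by
  have h : φ ∘ e.symm =ᶠ[𝓝 (e x)] fun _ => φ x := by
    have := e.continuousAt_symm (e.map_source hx)
    rw [ContinuousAt, e.left_inv hx] at this
    exact this.eventually hφ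
  have h1 : ∀ k, pderiv k (φ ∘ e.symm) =ᶠ[𝓝 (e x)] fun _ => 0 := fun k => by
    simpa only [pderiv_const] using pderiv_eventuallyEq (i := k) h
  have h2 : ∀ i k, pderiv i (pderiv k (φ ∘ e.symm)) (e x) = 0 := fun i k => by
    rw [pderiv_congr (h1 k), pderiv_const]
  simp [laplacianInChart, h2, fun k => (h1 k).self_of_nhds]

/-- The strong minimum principle near a point of a Riemannian manifold. -/
theorem eventually_eq_of_laplacianInChart_nonpos (g : Metric n M)
    (he : e ∈ IsManifold.maximalAtlas (𝓡 n) ∞ M) {φ : M → ℝ} (hφ : ContMDiff (𝓡 n) 𝓘(ℝ, ℝ) 2 φ)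
    (hΔ : ∀ x ∈ e.source, laplacianInChart g e φ (e x) ≤ 0) {x : M} (hx : x ∈ e.source)
    (hmin : ∀ᶠ y in 𝓝 x, φ x ≤ φ y) : ∀ᶠ y in 𝓝 x, φ y = φ x := by
  obtain ⟨V, hV, hVo, hxV⟩ := eventually_nhds_iff.mp hmin
  have hU : IsOpen (e.target ∩ e.symm ⁻¹' V) := e.isOpen_inter_preimage_symm hVo
  have hsub : e.target ∩ e.symm ⁻¹' V ⊆ e.target := Set.inter_subset_left
  have hφe : ContDiffOn ℝ 2 (φ ∘ e.symm) e.target := by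
    refine ContMDiffOn.contDiffOn ?_
    refine hφ.comp_contMDiffOn ((contMDiffOn_symm_of_mem_maximalAtlas he).of_le ?_)
    exact WithTop.coe_le_coe.mpr (le_top (a := (2 : ℕ∞)))
  have hdrift : ∀ k, ContinuousOn (laplacianDrift g e k) e.target := fun k =>
    continuousOn_finsetSum _ fun i _ => continuousOn_finsetSum _ fun j _ =>
      (continuousOn_gram_inv g he i j).mul (continuousOn_christoffel g he k i j).neg
  have hval : (φ ∘ e.symm) (e x) = φ x := by simp [e.left_inv hx]
  have key := eventually_eq_of_secondOrderOp_nonpos (u := φ ∘ e.symm)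
    (a := fun u => (gram g e u)⁻¹) (b := laplacianDrift g e) (x₀ := e x) hU
    (fun i j => (continuousOn_gram_inv g he i j).mono hsub) (fun k => (hdrift k).mono hsub)
    (fun u hu => (gram_posDef g he hu.1).inv) (hφe.mono hsub)
    (fun u hu => by
      rw [← laplacianInChart_eq_secondOrderOp]
      simpa [e.right_inv hu.1] using hΔ (e.symm u) (e.map_target hu.1))
    ⟨e.map_source hx, by simpa [e.left_inv hx] using hxV⟩
    (fun u hu => by
      rw [hval]
      exact hV _ hu.2)
  filter_upwards [(e.continuousAt hx).eventually key, e.open_source.mem_nhds hx] with y hy hys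
  simpa [e.left_inv hx, e.left_inv hys] using hy

end Chart

/-! ### Superharmonic functions on compact manifolds -/

/-- On a compact manifold every `C²` superharmonic function is locally constant. -/
theorem isLocallyConstant_of_laplacian_nonpos [CompactSpace M] (g : Metric n M) {φ : M → ℝ}
    (hφ : ContMDiff (𝓡 n) 𝓘(ℝ, ℝ) 2 φ)
    (hΔ : ∀ e ∈ IsManifold.maximalAtlas (𝓡 n) ∞ M, ∀ x ∈ e.source,
      laplacianInChart g e φ (e x) ≤ 0) : IsLocallyConstant φ := by
  have : LocallyConnectedSpace M := ChartedSpace.locallyConnectedSpace (𝔼 n) M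
  refine (IsLocallyConstant.iff_eventually_eq φ).mpr fun x => ?_
  have hopen : IsOpen (connectedComponent x) := isOpen_connectedComponent
  obtain ⟨p, hp, hpmin⟩ := (isClosed_connectedComponent (x := x)).isCompact.exists_isMinOn
    ⟨x, mem_connectedComponent⟩ hφ.continuous.continuousOn
  -- `M` may be disconnected, so each component gets its own minimum. The set attaining it is closed
  -- by continuity and open by the minimum principle.
  have hset : IsClopen (connectedComponent x ∩ φ ⁻¹' {φ p}) := by
    refine ⟨isClosed_connectedComponent.inter (isClosed_singleton.preimage hφ.continuous),
      isOpen_iff_mem_nhds.mpr ?_⟩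
    rintro y ⟨hy, hyp : φ y = φ p⟩
    have hmin : ∀ᶠ z in 𝓝 y, φ y ≤ φ z := by
      filter_upwards [hopen.mem_nhds hy] with z hz
      rw [hyp]
      exact hpmin hz
    filter_upwards [hopen.mem_nhds hy, eventually_eq_of_laplacianInChart_nonpos g
      (IsManifold.chart_mem_maximalAtlas y) hφ (hΔ _ (IsManifold.chart_mem_maximalAtlas y))
      (mem_chart_source _ y) hmin] with z hz hzy
    exact ⟨hz, hzy.trans hyp⟩
  have hsub := isPreconnected_connectedComponent.subset_isClopen hset ⟨p, hp, hp, rfl⟩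
  have hx : φ x = φ p := (hsub mem_connectedComponent).2
  filter_upwards [hopen.mem_nhds mem_connectedComponent] with y hy
  rw [hx]
  exact (hsub hy).2

/-! ### The cubic in `s = φ⁴` -/

section Algebra

variable {R b A s : ℝ}

/-- For `s > 0` the cubic `R s² - b s³` is at most `A`, as soon as `A b² ≥ (4/27) R³`. -/
lemma mul_sq_sub_mul_cube_le (hb : 0 < b) (hA : 0 ≤ A) (hs : 0 < s)
    (h : 4 / 27 * R ^ 3 ≤ A * b ^ 2) : R * s ^ 2 - b * s ^ 3 ≤ A := by
  rcases le_or_gt R 0 with hR | hR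
  · nlinarith [mul_nonneg (neg_nonneg.mpr hR) (sq_nonneg s), mul_pos hb (pow_pos hs 3)]
  -- The double root is the maximizer: `(3bs - 2R)² (3bs + R) = 4R³ - 27b² (R s² - b s³)`.
  · have hpos : 0 ≤ (3 * b * s - 2 * R) ^ 2 * (3 * b * s + R) := by positivity
    have : b ^ 2 * (R * s ^ 2 - b * s ^ 3) ≤ b ^ 2 * A := by nlinarith
    exact le_of_mul_le_mul_left this (by positivity)

/-- Equality with `A ≥ 0` forces `R > 0`; then the product `(3bs - 2R)² (3bs + R)` is at most zero
with a positive second factor, so `3bs = 2R`. -/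
lemma eq_of_mul_sq_sub_mul_cube_eq (hb : 0 < b) (hA : 0 ≤ A) (hs : 0 < s)
    (h : 4 / 27 * R ^ 3 ≤ A * b ^ 2) (heq : R * s ^ 2 - b * s ^ 3 = A) :
    0 < R ∧ s = 2 * R / (3 * b) ∧ A * b ^ 2 = 4 / 27 * R ^ 3 := by
  have hR : 0 < R := by
    have h3 := mul_pos hb (pow_pos hs 3)
    by_contra! hR
    nlinarith [mul_nonneg (neg_nonneg.mpr hR) (sq_nonneg s)]
  have hle : (3 * b * s - 2 * R) ^ 2 * (3 * b * s + R) ≤ 0 := by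
    subst heq
    nlinarith
  have hsq : (3 * b * s - 2 * R) ^ 2 = 0 := by
    refine le_antisymm ?_ (sq_nonneg _)
    exact nonpos_of_mul_nonpos_left hle (by positivity)
  have hlin : 3 * b * s = 2 * R := by
    have := pow_eq_zero_iff two_ne_zero |>.mp hsq
    linarith
  refine ⟨hR, ?_, ?_⟩
  · rw [eq_div_iff (by positivity)]
    linarith
  · have hRs : R = 3 * b * s / 2 := by linarith
    rw [← heq, hRs]
    ring

lemma nonlinearity_eq {f : ℝ} (hf : 0 < f) :
    R / 8 * f + (-(b / 8) * f ^ 5 - A / 8 * f ^ (-7 : ℤ))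
      = (R * (f ^ 4) ^ 2 - b * (f ^ 4) ^ 3 - A) / (8 * f ^ 7) := by
  have : f ^ (-7 : ℤ) = (f ^ 7)⁻¹ := by
    rw [zpow_neg]
    norm_cast
  rw [this]
  field_simp
  ring

lemma eq_rpow_of_pow_four_eq {f t : ℝ} (hf : 0 ≤ f) (h : f ^ 4 = t) :
    f = t ^ (1 / 4 : ℝ) := by
  rw [← h, ← Real.rpow_natCast, ← Real.rpow_mul hf]
  norm_num

lemma rpow_pow_four {t : ℝ} (ht : 0 ≤ t) : (t ^ (1 / 4 : ℝ)) ^ 4 = t := by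
  rw [← Real.rpow_natCast, ← Real.rpow_mul ht]
  norm_num

end Algebra

/-! ### Rigidity and the main result -/

/-- If `α² β⁴ ≥ (4/27) R³` pointwise on a compact manifold, then a positive solution of the
Lichnerowicz equation forces equality everywhere, and is determined by the coefficients. -/
theorem IsPositiveSolution.rigidity [CompactSpace M] {g : Metric n M} {R α β φ : M → ℝ}
    (hβ : ∀ x, 0 < β x ^ 2) (h : ∀ x, 4 / 27 * R x ^ 3 ≤ α x ^ 2 * (β x ^ 2) ^ 2)
    (hφ : IsPositiveSolution g R α β φ) (x : M) :
    0 < R x ∧ φ x ^ 4 = 2 * R x / (3 * β x ^ 2) ∧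
      α x ^ 2 * (β x ^ 2) ^ 2 = 4 / 27 * R x ^ 3 := by
  have heq : ∀ e ∈ IsManifold.maximalAtlas (𝓡 n) ∞ M, ∀ y ∈ e.source,
      laplacianInChart g e φ (e y)
        = (R y * (φ y ^ 4) ^ 2 - β y ^ 2 * (φ y ^ 4) ^ 3 - α y ^ 2) / (8 * φ y ^ 7) := by
    intro e he y hy
    rw [← nonlinearity_eq (hφ.pos y)]
    linarith [hφ.equation e he y hy]
  have hconst := isLocallyConstant_of_laplacian_nonpos g hφ.contMDiff fun e he y hy => by
    rw [heq e he y hy]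
    have hp := hφ.pos y
    refine div_nonpos_of_nonpos_of_nonneg ?_ (by positivity)
    linarith [mul_sq_sub_mul_cube_le (hβ y) (sq_nonneg (α y)) (pow_pos hp 4) (h y)]
  have hx := mem_chart_source (EuclideanSpace ℝ (Fin n)) x
  have hzero := heq _ (IsManifold.chart_mem_maximalAtlas x) x hx
  rw [laplacianInChart_eq_zero g hx ((IsLocallyConstant.iff_eventually_eq φ).mp hconst x)] at hzero
  have hp := hφ.pos x
  have hnum := (div_eq_zero_iff.mp hzero.symm).resolve_right (by positivity)
  exact eq_of_mul_sq_sub_mul_cube_eq (hβ x) (sq_nonneg _) (pow_pos hp 4) (h x) (by linarith)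

lemma isPositiveSolution_const (g : Metric n M) {R α β : M → ℝ} {c : ℝ} (hc : 0 < c)
    (h : ∀ x, R x * (c ^ 4) ^ 2 - β x ^ 2 * (c ^ 4) ^ 3 = α x ^ 2) :
    IsPositiveSolution g R α β fun _ => c where
  contMDiff := contMDiff_const
  pos _ := hc
  equation e _ x hx := by
    have := nonlinearity_eq (R := R x) (b := β x ^ 2) (A := α x ^ 2) hc
    rw [h x, sub_self, zero_div] at this
    rw [laplacianInChart_eq_zero g hx (by simp)]
    linarith

end Lichnerowicz

end

/-- All `⨅` and `⨆` are minima and maxima of continuous functions on a nonempty compact space. -/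
theorem proposition2p1 {n : ℕ} {M : Type*} [TopologicalSpace M] [T2Space M] [CompactSpace M]
    [Nonempty M] [ChartedSpace (EuclideanSpace ℝ (Fin n)) M] [IsManifold (𝓡 n) ∞ M]
    (g : Lichnerowicz.Metric n M) (R α β : M → ℝ)
    (hR : Continuous R) (hα : Continuous α) (hβ : Continuous β) (hβpos : ∀ x, 0 < β x ^ 2)
    (hineq : (⨅ x, α x ^ 2) * (⨅ x, β x ^ 4) ≥ 4 / 27 * ⨆ x, R x ^ 3) :
    (¬ (∃ R₀ A B : ℝ, 0 < R₀ ∧ 0 < A ∧ 0 < B ∧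
          (∀ x, R x = R₀ ∧ α x ^ 2 = A ∧ β x ^ 2 = B) ∧
          (⨅ x, α x ^ 2) * (⨅ x, β x ^ 4) = 4 / 27 * ⨆ x, R x ^ 3) →
        ¬ ∃ φ : M → ℝ, Lichnerowicz.IsPositiveSolution g R α β φ) ∧
    (∀ R₀ A B : ℝ, 0 < R₀ → 0 < A → 0 < B →
        (∀ x, R x = R₀ ∧ α x ^ 2 = A ∧ β x ^ 2 = B) →
        (⨅ x, α x ^ 2) * (⨅ x, β x ^ 4) = 4 / 27 * (⨆ x, R x ^ 3) →
        ∀ φ : M → ℝ, Lichnerowicz.IsPositiveSolution g R α β φ ↔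
          φ = fun _ => (2 * R₀ / (3 * B)) ^ (1 / 4 : ℝ)) := by
  have hβ4 : ∀ x, β x ^ 4 = (β x ^ 2) ^ 2 := fun x => by ring
  have hinfα : ∀ x, ⨅ y, α y ^ 2 ≤ α x ^ 2 := fun x =>
    ciInf_le (isCompact_range (hα.pow 2)).bddBelow x
  have hinfβ : ∀ x, ⨅ y, β y ^ 4 ≤ β x ^ 4 := fun x =>
    ciInf_le (isCompact_range (hβ.pow 4)).bddBelow x
  have hinfα0 : 0 ≤ ⨅ y, α y ^ 2 := Real.iInf_nonneg fun y => sq_nonneg _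
  have hinfβ0 : 0 ≤ ⨅ y, β y ^ 4 := Real.iInf_nonneg fun y => by positivity
  have hsupR : ∀ x, R x ^ 3 ≤ ⨆ y, R y ^ 3 := fun x =>
    le_ciSup (isCompact_range (hR.pow 3)).bddAbove x
  -- Three independent points: comparing with the equality at a single point lets one coefficient
  -- vary at a time.
  have hpoint : ∀ x y z, 4 / 27 * R x ^ 3 ≤ α y ^ 2 * (β z ^ 2) ^ 2 := fun x y z => by
    have h1 := mul_le_mul (hinfα y) (hinfβ z) hinfβ0 (sq_nonneg _)
    rw [hβ4] at h1
    linarith [hsupR x]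
  constructor
  · rintro hnot ⟨φ, hφ⟩
    apply hnot
    have hrig := hφ.rigidity hβpos fun x => hpoint x x x
    have hα2 : ∀ x, 0 < α x ^ 2 := fun x => by
      obtain ⟨hRx, -, heq⟩ := hrig x
      have : 0 < α x ^ 2 * (β x ^ 2) ^ 2 := by
        rw [heq]
        positivity
      exact pos_of_mul_pos_left this (sq_nonneg _)
    have hαle : ∀ x y, α x ^ 2 ≤ α y ^ 2 := fun x y =>
      le_of_mul_le_mul_right ((hrig x).2.2.trans_le (hpoint x y x)) (pow_pos (hβpos x) 2)
    have hβle : ∀ x y, β x ^ 2 ≤ β y ^ 2 := fun x y =>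
      le_of_sq_le_sq (le_of_mul_le_mul_left ((hrig x).2.2.trans_le (hpoint x x y)) (hα2 x))
        (hβpos y).le
    have hRle : ∀ x y, R x ≤ R y := fun x y => by
      have h1 := (hpoint x y y).trans_eq (hrig y).2.2
      exact le_of_pow_le_pow_left₀ three_ne_zero (hrig y).1.le (by linarith)
    obtain ⟨p⟩ := ‹Nonempty M›
    have hRp : ∀ x, R x = R p := fun x => le_antisymm (hRle x p) (hRle p x)
    have hαp : ∀ x, α x ^ 2 = α p ^ 2 := fun x => le_antisymm (hαle x p) (hαle p x)
    have hβp : ∀ x, β x ^ 2 = β p ^ 2 := fun x => le_antisymm (hβle x p) (hβle p x)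
    refine ⟨R p, α p ^ 2, β p ^ 2, (hrig p).1, hα2 p, hβpos p,
      fun x => ⟨hRp x, hαp x, hβp x⟩, ?_⟩
    have : Nonempty M := ⟨p⟩
    simp only [hβ4, hRp, hαp, hβp, ciInf_const, ciSup_const]
    exact (hrig p).2.2
  · intro R₀ A B hR₀ hA hB hconst heq φ
    have hbal : A * B ^ 2 = 4 / 27 * R₀ ^ 3 := by
      simpa only [hβ4, fun x => (hconst x).1, fun x => (hconst x).2.1, fun x => (hconst x).2.2,
        ciInf_const, ciSup_const] using heq
    have ht : 0 < 2 * R₀ / (3 * B) := by positivity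
    constructor
    · intro hφ
      funext x
      have h4 := (hφ.rigidity hβpos (fun x => hpoint x x x) x).2.1
      rw [(hconst x).1, (hconst x).2.2] at h4
      exact Lichnerowicz.eq_rpow_of_pow_four_eq (hφ.pos x).le h4
    · rintro rfl
      refine Lichnerowicz.isPositiveSolution_const g (Real.rpow_pos_of_pos ht _) fun x => ?_
      rw [(hconst x).1, (hconst x).2.1, (hconst x).2.2, Lichnerowicz.rpow_pow_four ht.le]
      have hA' : A = 4 / 27 * R₀ ^ 3 / B ^ 2 := by
        rw [eq_div_iff (by positivity), hbal]
      rw [hA']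
      field_simp
      ring
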